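/- Let $\mathcal W=\mathbb C\langle a,a^\dagger\rangle/(aa^\dagger-a^\dagger a-1)$ be the Heisenberg--Weyl algebra. For $s\in\mathbb C$ let $F\mapsto\, :\!F\!:_s$ be the $\mathbb C$-linear map ($s$-ordering) from the polynomial ring $\mathbb C[\alpha,\alpha^*]$ in commuting indeterminates to $\mathcal W$ determined by $$e^{s\beta(-\beta^*)/2}\exp(\beta a^\dagger-\beta^* a)=\sum_{n,m\ge 0}\frac{\beta^n(-\beta^*)^m}{n!\,m!}\,:\!{\alpha^*}^n\alpha^m\!:_s$$ in $\mathcal W[[\beta,\beta^*]]$; inside $:\cdots:_s$ one writes $a,a^\dagger$ for the commuting $\alpha,\alpha^*$. For $A,B,r,r',s\in\mathbb C$ define the formal power series in $D$ $$g_T(D)=\tfrac{1+s}2\left[\frac{1+\frac{1-s}2BD}{1-\frac{1+s}2BD}\right]^{-r/B}+\tfrac{1-s}2\left[\frac{1-\frac{1+s}2BD}{1+\frac{1-s}2BD}\right]^{r'/B},$$ $$f_T(D)=\frac{[1-\frac{1+s}2BD]^{-A/B}-1}{A}+\frac{[1+\frac{1-s}2BD]^{-A/B}-1}{-A},$$ the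 cases $A=0$, $B=0$ being understood as (coefficientwise) limits. Let $\bar f_T$ be the compositional inverse of $f_T$, put $\bar g_T=1/(g_T\circ\bar f_T)$, and let the two-point Hsu--Shiue polynomials $T_n(t)=T_n(t;A,B,r,r';s)=\mathbf S[g_T,f_T]_n(t)$ be the Sheffer polynomials defined by $$\sum_{n\ge 0}T_n(t)\frac{z^n}{n!}=\bar g_T(z)\,e^{t\bar f_T(z)}.$$ Then for all integers $L,R\ge 0$ with $e=L+R-1\ge 0$, all $s\in\mathbb C$ and all integers $n\ge 0$, $$({a^\dagger}^L a\,{a^\dagger}^R)^n=\;:\!({a^\dagger}^{e})^n\,T_n(a^\dagger a;\,e,1,-L,R;\,s)\!:_s .$$ -/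

import Mathlib

open scoped Nat

noncomputable section

namespace BosonOrdering

/-! ### The Heisenberg-Weyl algebra

The index `0 : Fin 2` stands for the creation operator and `1 : Fin 2` for the annihilation
operator; the same indexing is used for every pair of commuting variables below. -/

/-- The relation `a a† = a† a + 1` on the free algebra. -/
inductive WeylRel : FreeAlgebra ℂ (Fin 2) → FreeAlgebra ℂ (Fin 2) → Prop
  | ccr : WeylRel (FreeAlgebra.ι ℂ 1 * FreeAlgebra.ι ℂ 0)
      (FreeAlgebra.ι ℂ 0 * FreeAlgebra.ι ℂ 1 + 1)

/-- The single-mode Heisenberg-Weyl algebra `ℂ⟨a, a†⟩ / (a a† - a† a - 1)`. -/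
abbrev Weyl : Type := RingQuot WeylRel

/-- The creation operator `a†`. -/
def adag : Weyl := RingQuot.mkAlgHom ℂ WeylRel (FreeAlgebra.ι ℂ 0)

/-- The annihilation operator `a`. -/
def ann : Weyl := RingQuot.mkAlgHom ℂ WeylRel (FreeAlgebra.ι ℂ 1)

/-! ### `s`-ordering -/

/-- The exponential `∑ p, G ^ p / p!` of a power series `G` in two commuting (central) variables
with coefficients in the Heisenberg-Weyl algebra and with zero constant term.  The powers `G ^ p`
with `p` larger than the total degree of `d` do not contribute to the coefficient at `d`, see
`coeff_pow_eq_zero`. -/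
def expSeries (G : MvPowerSeries (Fin 2) Weyl) : MvPowerSeries (Fin 2) Weyl :=
  fun d => ∑ p ∈ Finset.range (d.degree + 1), ((p ! : ℂ)⁻¹) • MvPowerSeries.coeff d (G ^ p)

theorem coeff_pow_eq_zero (G : MvPowerSeries (Fin 2) Weyl)
    (hG : MvPowerSeries.constantCoeff G = 0) (p : ℕ) :
    ∀ d : Fin 2 →₀ ℕ, d.degree < p → MvPowerSeries.coeff d (G ^ p) = 0 := by
  induction p with
  | zero => intro d hd; omega
  | succ p ih =>
    intro d hd
    rw [pow_succ, MvPowerSeries.coeff_mul]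
    refine Finset.sum_eq_zero fun x hx => ?_
    have hx' : x.1 + x.2 = d := by simpa using hx
    by_cases h2 : x.2 = 0
    · rw [h2, MvPowerSeries.coeff_zero_eq_constantCoeff_apply, hG, mul_zero]
    · have h3 : x.2.degree ≠ 0 := by
        rw [Ne, Finsupp.degree_eq_zero_iff]; exact h2
      have h4 : x.1.degree + x.2.degree = d.degree := by
        rw [← hx', map_add]
      rw [ih x.1 (by omega), zero_mul]

/-- The deformed displacement operator
`D(β, β*; s) = exp (s β (-β*) / 2) * exp (β a† + (-β*) a)`, as a power series in the two
independent commuting variables `β` (index `0`) and `-β*` (index `1`). -/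
def displacement (s : ℂ) : MvPowerSeries (Fin 2) Weyl :=
  expSeries (MvPowerSeries.monomial (Finsupp.single 0 1 + Finsupp.single 1 1)
      (algebraMap ℂ Weyl (s / 2))) *
    expSeries (MvPowerSeries.monomial (Finsupp.single 0 1) adag +
      MvPowerSeries.monomial (Finsupp.single 1 1) ann)

/-- The `s`-quantization map `F ↦ :F:_s`.  A polynomial in the two commuting variables `α*`
(index `0`) and `α` (index `1`) is sent to an element of the Heisenberg-Weyl algebra; the map is
linear and the monomial `α* ^ n * α ^ m` is sent to the derivative
`∂ ^ (n + m) / ∂β ^ n ∂(-β*) ^ m` of `D(β, β*; s)` at the origin, i.e. to `n! m!` times the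
coefficient of `β ^ n (-β*) ^ m`. -/
def sOrder (s : ℂ) : MvPolynomial (Fin 2) ℂ →ₗ[ℂ] Weyl :=
  (MvPolynomial.basisMonomials (Fin 2) ℂ).constr ℂ fun d =>
    (((d 0)! : ℂ) * ((d 1)! : ℂ)) • MvPowerSeries.coeff d (displacement s)

/-- The commuting variable `α*` corresponding to `a†`. -/
def αstar : MvPolynomial (Fin 2) ℂ := MvPolynomial.X 0

/-- The commuting variable `α` corresponding to `a`. -/
def α : MvPolynomial (Fin 2) ℂ := MvPolynomial.X 1

/-! ### Exponential Riordan and Sheffer polynomials -/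

/-- The `n`-th row polynomial of the exponential Riordan array of `[d, h]`: its `k`-th coefficient
is `(n! / k!) [z ^ n] (d(z) h(z) ^ k)`, `0 ≤ k ≤ n`; for `h` without constant term this says that
`d(z) exp (t h(z))` is the exponential generating function of the row polynomials. -/
def riordanPoly (d h : PowerSeries ℂ) (n : ℕ) : Polynomial ℂ :=
  ∑ k ∈ Finset.range (n + 1),
    Polynomial.C ((n ! : ℂ) / (k ! : ℂ) * PowerSeries.coeff n (d * h ^ k)) * Polynomial.X ^ k

/-- The `n`-th Sheffer polynomial `S[g, f]_n` of a pair of series of orders `0` and `1`: the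
exponential Riordan polynomial of `[1 / g(f̄(z)), f̄(z)]`, where `f̄` is the compositional inverse
of `f`. -/
def shefferPoly (g f : PowerSeries ℂ) (hf : IsUnit (PowerSeries.coeff 1 f)) (n : ℕ) :
    Polynomial ℂ :=
  riordanPoly (g.subst (f.substInvOfIsUnit hf) : PowerSeries ℂ)⁻¹ (f.substInvOfIsUnit hf) n

/-! ### The two-point Hsu-Shiue polynomials -/

/-- The series `(1 + B c D) ^ (ρ / B)` in `D`, including its limit `exp (ρ c D)` at `B = 0`.  The
coefficient of `D ^ k` is `ρ (ρ - B) ⋯ (ρ - (k - 1) B) c ^ k / k!`. -/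
def powSeries (B ρ c : ℂ) : PowerSeries ℂ :=
  PowerSeries.mk fun k => (∏ j ∈ Finset.range k, (ρ - j * B)) * c ^ k / (k ! : ℂ)

/-- The series `((1 + B c D) ^ (-A / B) - 1) / A` in `D`, including its limits at `A = 0` and
`B = 0`: the common factor `-A` of the nonconstant coefficients of `powSeries B (-A) c` has been
divided by `A`. -/
def powSubOneDiv (A B c : ℂ) : PowerSeries ℂ :=
  PowerSeries.mk fun k => if k = 0 then 0 else
    -(∏ j ∈ Finset.Ico 1 k, (-A - j * B)) * c ^ k / (k ! : ℂ)

/-- The series `g_T(D; B, r, r'; s)`, that is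
`(1+s)/2 * [(1 + (1-s)/2 B D) / (1 - (1+s)/2 B D)] ^ (-r/B) +
 (1-s)/2 * [(1 - (1+s)/2 B D) / (1 + (1-s)/2 B D)] ^ (r'/B)`. -/
def gT (B r r' s : ℂ) : PowerSeries ℂ :=
  PowerSeries.C ((1 + s) / 2) *
      (powSeries B (-r) ((1 - s) / 2) * powSeries B r (-((1 + s) / 2))) +
    PowerSeries.C ((1 - s) / 2) *
      (powSeries B r' (-((1 + s) / 2)) * powSeries B (-r') ((1 - s) / 2))

/-- The series `f_T(D; A, B; s)`, that is
`([1 - (1+s)/2 B D] ^ (-A/B) - 1) / A + ([1 + (1-s)/2 B D] ^ (-A/B) - 1) / (-A)`. -/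
def fT (A B s : ℂ) : PowerSeries ℂ :=
  powSubOneDiv A B (-((1 + s) / 2)) - powSubOneDiv A B ((1 - s) / 2)

theorem constantCoeff_fT (A B s : ℂ) : PowerSeries.constantCoeff (fT A B s) = 0 := by
  rw [← PowerSeries.coeff_zero_eq_constantCoeff_apply]
  simp [fT, powSubOneDiv]

theorem coeff_one_fT (A B s : ℂ) : PowerSeries.coeff 1 (fT A B s) = 1 := by
  simp [fT, powSubOneDiv]
  ring

theorem isUnit_coeff_one_fT (A B s : ℂ) : IsUnit (PowerSeries.coeff 1 (fT A B s)) := by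
  rw [coeff_one_fT]
  exact isUnit_one

theorem constantCoeff_gT (B r r' s : ℂ) : PowerSeries.constantCoeff (gT B r r' s) = 1 := by
  have h (ρ c : ℂ) : PowerSeries.constantCoeff (powSeries B ρ c) = 1 := by
    rw [← PowerSeries.coeff_zero_eq_constantCoeff_apply]
    simp [powSeries]
  simp only [gT, map_add, map_mul, h, PowerSeries.constantCoeff_C]
  ring

/-- The two-point Hsu-Shiue polynomial `T_n(t; A, B, r, r'; s) = S[g_T, f_T]_n(t)`. -/
def twoPointHS (A B r r' s : ℂ) (n : ℕ) : Polynomial ℂ :=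
  shefferPoly (gT B r r' s) (fT A B s) (isUnit_coeff_one_fT A B s) n

end BosonOrdering

end

open BosonOrdering

namespace BosonOrdering

noncomputable section

/-! ### Euler operators on power series with coefficients in the Heisenberg-Weyl algebra -/

/-! Left multiplication by `adag` and `ann` is transported to symbols, and the identity is proved by
induction on `n`.

Write c = (1+s)/2, c' = (1-s)/2, so that c + c' = 1. First-order differential equations for the
displacement series give a† :F:_s = :(α* - c ∂_α)F:_s and a :F:_s = :(α + c' ∂_{α*})F:_s
(`adag_mul_sOrder`, `ann_mul_sOrder`). On symbols α*^m p(α*α), where p is a row polynomial of the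
array [F, h], these rules act on generating functions F(z) exp(t h(z)): differentiation in t
multiplies F by h, so each a† multiplies F by Q = 1 - c h, while a brings in P = 1 + c' h, a factor
t and a multiple of c'.

Since a†^L a a†^R = a a†^(e+1) - L a†^e, the induction step reduces to one recurrence,
`riordanPoly_gbar_succ`. For h the inverse of f_T and ρ the reciprocal of g_T ∘ h, it follows from e
z = Q^(-e) - P^(-e), ρ (c (P/Q)^L + c' (Q/P)^R) = 1 and (c Q^(-e-1) + c' P^(-e-1)) h' = 1. With F =
ρ - c' e z ρ Q^(e+1), the first two give F = P^(R-e) Q^L, from which F h' = ρ P Q^(e+1) and F' = c'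
ρ Q^(e+1) - L ρ Q^e. -/

/-- The Euler operator multiplying the coefficient at `d` by the weight `w d`. -/
def eulerOp (w : (Fin 2 →₀ ℕ) →+ ℕ) : MvPowerSeries (Fin 2) Weyl →+ MvPowerSeries (Fin 2) Weyl where
  toFun F := fun d => w d • MvPowerSeries.coeff d F
  map_zero' := by ext d; exact smul_zero _
  map_add' F G := by ext d; exact smul_add _ _ _

theorem coeff_eulerOp (w : (Fin 2 →₀ ℕ) →+ ℕ) (F : MvPowerSeries (Fin 2) Weyl) (d : Fin 2 →₀ ℕ) :
    MvPowerSeries.coeff d (eulerOp w F) = w d • MvPowerSeries.coeff d F := rfl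

theorem eulerOp_mul (w : (Fin 2 →₀ ℕ) →+ ℕ) (F G : MvPowerSeries (Fin 2) Weyl) :
    eulerOp w (F * G) = eulerOp w F * G + F * eulerOp w G := by
  ext d
  simp only [coeff_eulerOp, map_add, MvPowerSeries.coeff_mul, Finset.smul_sum,
    ← Finset.sum_add_distrib]
  refine Finset.sum_congr rfl fun x hx => ?_
  have hx' : x.1 + x.2 = d := by simpa using hx
  rw [← hx', map_add, add_smul, smul_mul_assoc, mul_smul_comm]

theorem eulerOp_monomial (w : (Fin 2 →₀ ℕ) →+ ℕ) (e : Fin 2 →₀ ℕ) (x : Weyl) :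
    eulerOp w (MvPowerSeries.monomial e x) = w e • MvPowerSeries.monomial e x := by
  ext d
  rw [coeff_eulerOp, map_nsmul, MvPowerSeries.coeff_monomial]
  split_ifs with h
  · rw [h]
  · simp

theorem eulerOp_comm (w w' : (Fin 2 →₀ ℕ) →+ ℕ) (F : MvPowerSeries (Fin 2) Weyl) :
    eulerOp w (eulerOp w' F) = eulerOp w' (eulerOp w F) := by
  ext d
  simp only [coeff_eulerOp]
  rw [smul_comm]

theorem eulerOp_pow (w : (Fin 2 →₀ ℕ) →+ ℕ) (G : MvPowerSeries (Fin 2) Weyl)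
    (hG : Commute (eulerOp w G) G) (p : ℕ) :
    eulerOp w (G ^ (p + 1)) = (p + 1) • (eulerOp w G * G ^ p) := by
  induction p with
  | zero => simp
  | succ p ih =>
    rw [pow_succ, eulerOp_mul, ih, smul_mul_assoc, mul_assoc, ← pow_succ,
      ← (hG.pow_right (p + 1)).eq, succ_nsmul _ (p + 1)]

theorem coeff_expSeries (G : MvPowerSeries (Fin 2) Weyl)
    (hG : MvPowerSeries.constantCoeff G = 0) (d : Fin 2 →₀ ℕ) (N : ℕ) (hN : d.degree < N) :
    MvPowerSeries.coeff d (expSeries G) =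
      ∑ p ∈ Finset.range N, ((p ! : ℂ)⁻¹) • MvPowerSeries.coeff d (G ^ p) := by
  refine Finset.sum_subset (Finset.range_mono hN) fun p _ hp => ?_
  rw [coeff_pow_eq_zero G hG p d (by simpa using hp), smul_zero]

theorem constantCoeff_expSeries (G : MvPowerSeries (Fin 2) Weyl) :
    MvPowerSeries.coeff 0 (expSeries G) = 1 := by
  change ∑ p ∈ Finset.range ((0 : Fin 2 →₀ ℕ).degree + 1), _ = _
  simp

theorem eulerOp_expSeries (w : (Fin 2 →₀ ℕ) →+ ℕ) (G : MvPowerSeries (Fin 2) Weyl)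
    (hG : MvPowerSeries.constantCoeff G = 0) (hc : Commute (eulerOp w G) G) :
    eulerOp w (expSeries G) = eulerOp w G * expSeries G := by
  ext d
  have hR : MvPowerSeries.coeff d (eulerOp w G * expSeries G) =
      ∑ p ∈ Finset.range (d.degree + 1),
        ((p ! : ℂ)⁻¹) • MvPowerSeries.coeff d (eulerOp w G * G ^ p) := by
    simp only [MvPowerSeries.coeff_mul, Finset.smul_sum]
    rw [Finset.sum_comm]
    refine Finset.sum_congr rfl fun x hx => ?_
    have hx' : x.1 + x.2 = d := by simpa using hx
    have : x.2.degree ≤ d.degree := by rw [← hx', map_add]; omega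
    rw [coeff_expSeries G hG x.2 (d.degree + 1) (by omega), Finset.mul_sum]
    exact Finset.sum_congr rfl fun p _ => by rw [mul_smul_comm]
  -- One term more than the degree requires is kept, so that the range matches `hR` after splitting
  -- off the term `p = 0`.
  rw [hR, coeff_eulerOp, coeff_expSeries G hG d (d.degree + 1 + 1) (by omega),
    Finset.sum_range_succ', smul_add]
  have h0 : w d • (((0 ! : ℕ) : ℂ)⁻¹ • MvPowerSeries.coeff d (G ^ 0)) = 0 := by
    rw [pow_zero, MvPowerSeries.coeff_one]
    split_ifs with h
    · simp [h]
    · simp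
  rw [h0, add_zero, Finset.smul_sum]
  refine Finset.sum_congr rfl fun p _ => ?_
  rw [smul_comm, ← coeff_eulerOp, eulerOp_pow w G hc, map_nsmul, ← Nat.cast_smul_eq_nsmul ℂ,
    smul_smul]
  congr 1
  have : (p ! : ℂ) ≠ 0 := by exact_mod_cast p.factorial_ne_zero
  rw [Nat.factorial_succ]
  push_cast
  field_simp

/-- Uniqueness for a first-order equation: multiplication by `G` raises the degree, so each
coefficient of `U` times its nonzero degree is determined by coefficients of lower degree, which
vanish inductively. -/
theorem eq_zero_of_eulerOp_eq_mul (G U : MvPowerSeries (Fin 2) Weyl)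
    (hG : MvPowerSeries.constantCoeff G = 0) (hU : MvPowerSeries.constantCoeff U = 0)
    (h : eulerOp Finsupp.degree U = G * U) : U = 0 := by
  have key : ∀ n : ℕ, ∀ d : Fin 2 →₀ ℕ, d.degree < n → MvPowerSeries.coeff d U = 0 := by
    intro n
    induction n with
    | zero => intro d hd; omega
    | succ n ih =>
      intro d hd
      by_cases hd0 : d = 0
      · rw [hd0, MvPowerSeries.coeff_zero_eq_constantCoeff_apply, hU]
      have h1 : d.degree • MvPowerSeries.coeff d U = 0 := by
        rw [← coeff_eulerOp, h, MvPowerSeries.coeff_mul]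
        refine Finset.sum_eq_zero fun x hx => ?_
        have hx' : x.1 + x.2 = d := by simpa using hx
        by_cases h2 : x.1 = 0
        · rw [h2, MvPowerSeries.coeff_zero_eq_constantCoeff_apply, hG, zero_mul]
        · have h3 : x.1.degree ≠ 0 := by
            rw [Ne, Finsupp.degree_eq_zero_iff]; exact h2
          have h4 : x.1.degree + x.2.degree = d.degree := by rw [← hx', map_add]
          rw [ih x.2 (by omega), mul_zero]
      have h3 : (d.degree : ℂ) ≠ 0 := by
        rw [Nat.cast_ne_zero, Ne, Finsupp.degree_eq_zero_iff]; exact hd0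
      rw [← Nat.cast_smul_eq_nsmul ℂ] at h1
      exact (smul_eq_zero_iff_right h3).1 h1
  ext d
  exact key (d.degree + 1) d (Nat.lt_succ_self _)

/-! ### Differential equations of the displacement operator -/

theorem ann_mul_adag : ann * adag = adag * ann + 1 := by
  have h := RingQuot.mkAlgHom_rel ℂ WeylRel.ccr
  rw [map_mul, map_add, map_mul, map_one] at h
  exact h

/-- The exponent of the variable with index `i`. -/
abbrev varExp (i : Fin 2) : Fin 2 →₀ ℕ := Finsupp.single i 1

/-- The scalar `c` times the product of the two variables. -/
def scalarSeries (c : ℂ) : MvPowerSeries (Fin 2) Weyl :=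
  MvPowerSeries.monomial (varExp 0 + varExp 1) (algebraMap ℂ Weyl c)

theorem constantCoeff_monomial_of_ne_zero {e : Fin 2 →₀ ℕ} (he : e ≠ 0) (x : Weyl) :
    MvPowerSeries.constantCoeff (MvPowerSeries.monomial e x) = 0 := by
  rw [← MvPowerSeries.coeff_zero_eq_constantCoeff_apply, MvPowerSeries.coeff_monomial,
    if_neg he.symm]

theorem constantCoeff_scalarSeries (c : ℂ) :
    MvPowerSeries.constantCoeff (scalarSeries c) = 0 := by
  refine constantCoeff_monomial_of_ne_zero (fun h => ?_) _
  simpa using DFunLike.congr_fun h 0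

/-- The undeformed displacement operator. -/
def weylSeries : MvPowerSeries (Fin 2) Weyl :=
  expSeries (MvPowerSeries.monomial (varExp 0) adag + MvPowerSeries.monomial (varExp 1) ann)

theorem displacement_eq (s : ℂ) :
    displacement s = expSeries (scalarSeries (s / 2)) * weylSeries := rfl

theorem commute_scalarSeries (c : ℂ) (F : MvPowerSeries (Fin 2) Weyl) :
    Commute F (scalarSeries c) :=
  (MvPowerSeries.commute_monomial F).2 fun _ => (Algebra.commutes c _).symm

theorem scalarSeries_add (c c' : ℂ) :
    scalarSeries (c + c') = scalarSeries c + scalarSeries c' := by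
  simp [scalarSeries]

theorem eulerOp_weylSeries :
    eulerOp Finsupp.degree weylSeries =
      (MvPowerSeries.monomial (varExp 0) adag + MvPowerSeries.monomial (varExp 1) ann) *
        weylSeries := by
  have h : eulerOp Finsupp.degree
      (MvPowerSeries.monomial (varExp 0) adag + MvPowerSeries.monomial (varExp 1) ann) =
      MvPowerSeries.monomial (varExp 0) adag + MvPowerSeries.monomial (varExp 1) ann := by
    simp [eulerOp_monomial]
  rw [weylSeries, eulerOp_expSeries, h]
  · simp [constantCoeff_monomial_of_ne_zero]
  · rw [h]

/-- The exponent of the variable with index `i` as a weight. -/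
abbrev varWeight (i : Fin 2) : (Fin 2 →₀ ℕ) →+ ℕ := Finsupp.applyAddHom i

theorem eulerOp_degree_eq (F : MvPowerSeries (Fin 2) Weyl) :
    eulerOp Finsupp.degree F = eulerOp (varWeight 0) F + eulerOp (varWeight 1) F := by
  ext d
  simp [coeff_eulerOp, Finsupp.degree_eq_sum, add_mul]

theorem monomial_ann_mul_monomial_adag :
    (MvPowerSeries.monomial (varExp 1) ann * MvPowerSeries.monomial (varExp 0) adag :
      MvPowerSeries (Fin 2) Weyl) =
    MvPowerSeries.monomial (varExp 0) adag * MvPowerSeries.monomial (varExp 1) ann +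
      (scalarSeries (1 / 2) + scalarSeries (1 / 2)) := by
  rw [MvPowerSeries.monomial_mul_monomial, MvPowerSeries.monomial_mul_monomial,
    ← scalarSeries_add, scalarSeries, add_comm (varExp 1), ann_mul_adag, map_add]
  norm_num

/-- This replaces the Baker-Campbell-Hausdorff formula. With A = β a†, N = -β* a and M half the
product of the variables, [N, A] = 2M is central. The difference of the two sides then satisfies the
same degree equation as `weylSeries` and has no constant term, hence vanishes; the 2M from the
commutator cancels the one from the degree 2 of M. -/
theorem eulerOp_zero_weylSeries :
    eulerOp (varWeight 0) weylSeries =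
      (MvPowerSeries.monomial (varExp 0) adag + scalarSeries (1 / 2)) * weylSeries := by
  rw [← sub_eq_zero]
  set A : MvPowerSeries (Fin 2) Weyl := MvPowerSeries.monomial (varExp 0) adag with hA
  set N : MvPowerSeries (Fin 2) Weyl := MvPowerSeries.monomial (varExp 1) ann with hN
  set M := scalarSeries (1 / 2) with hM
  have hAN : N * A = A * N + (M + M) := monomial_ann_mul_monomial_adag
  refine eq_zero_of_eulerOp_eq_mul (A + N) _ ?_ ?_ ?_
  · simp [hA, hN, constantCoeff_monomial_of_ne_zero]
  · rw [map_sub, map_mul, map_add]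
    have h1 : MvPowerSeries.constantCoeff (eulerOp (varWeight 0) weylSeries) = 0 := by
      rw [← MvPowerSeries.coeff_zero_eq_constantCoeff_apply, coeff_eulerOp]
      simp
    simp [h1, hA, hM, constantCoeff_scalarSeries, constantCoeff_monomial_of_ne_zero]
  · have hV : eulerOp Finsupp.degree weylSeries = (A + N) * weylSeries := eulerOp_weylSeries
    have hdA : eulerOp Finsupp.degree A = A := by simp [hA, eulerOp_monomial]
    have hdM : eulerOp Finsupp.degree M = M + M := by
      simp [hM, scalarSeries, eulerOp_monomial, two_mul]
    have h0 : eulerOp (varWeight 0) (A + N) = A := by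
      simp [hA, hN, eulerOp_monomial]
    have hMc (F : MvPowerSeries (Fin 2) Weyl) : F * M = M * F := (commute_scalarSeries _ F).eq
    rw [map_sub, eulerOp_comm, hV, eulerOp_mul, h0, eulerOp_mul, map_add, hdA, hdM, hV]
    have e1 := congrArg (· * weylSeries) hAN
    have e2 := congrArg (· * weylSeries) (hMc A)
    have e3 := congrArg (· * weylSeries) (hMc N)
    simp only [mul_add, add_mul, mul_sub, ← mul_assoc] at e1 e2 e3 ⊢
    rw [e1, e2, e3]
    abel

theorem eulerOp_one_weylSeries :
    eulerOp (varWeight 1) weylSeries =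
      (MvPowerSeries.monomial (varExp 1) ann + scalarSeries (-(1 / 2))) * weylSeries := by
  have h := eulerOp_weylSeries
  rw [eulerOp_degree_eq, eulerOp_zero_weylSeries, add_mul, add_mul, add_assoc,
    add_right_inj] at h
  have h' : scalarSeries (1 / 2) + scalarSeries (-(1 / 2)) = 0 := by
    rw [← scalarSeries_add]; simp [scalarSeries]
  rw [add_mul, ← h, add_right_comm, ← add_mul, h', zero_mul, zero_add]

theorem eulerOp_expSeries_scalarSeries (i : Fin 2) (c : ℂ) :
    eulerOp (varWeight i) (expSeries (scalarSeries c)) =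
      scalarSeries c * expSeries (scalarSeries c) := by
  have h : eulerOp (varWeight i) (scalarSeries c) = scalarSeries c := by
    rw [scalarSeries, eulerOp_monomial]
    fin_cases i <;> simp
  rw [eulerOp_expSeries, h]
  · exact constantCoeff_scalarSeries c
  · exact commute_scalarSeries _ _

theorem scalarSeries_pow (c : ℂ) (p : ℕ) : scalarSeries c ^ p =
    MvPowerSeries.monomial (p • (varExp 0 + varExp 1)) (algebraMap ℂ Weyl (c ^ p)) := by
  induction p with
  | zero => simp
  | succ p ih =>
    rw [pow_succ, ih, scalarSeries, MvPowerSeries.monomial_mul_monomial, ← map_mul, ← pow_succ,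
      ← succ_nsmul]

theorem commute_expSeries_scalarSeries (c : ℂ) (e : Fin 2 →₀ ℕ) (x : Weyl) :
    Commute (expSeries (scalarSeries c)) (MvPowerSeries.monomial e x) := by
  refine (MvPowerSeries.commute_monomial _).2 fun d => ?_
  change Commute (∑ p ∈ Finset.range (d.degree + 1), _) x
  refine Commute.sum_left _ _ _ fun p _ => Commute.smul_left ?_ _
  rw [scalarSeries_pow, MvPowerSeries.coeff_monomial]
  split_ifs
  · exact Algebra.commutes _ _
  · exact Commute.zero_left _

theorem eulerOp_zero_displacement (s : ℂ) :
    eulerOp (varWeight 0) (displacement s) =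
      (MvPowerSeries.monomial (varExp 0) adag + scalarSeries ((1 + s) / 2)) *
        displacement s := by
  rw [displacement_eq, eulerOp_mul, eulerOp_expSeries_scalarSeries, eulerOp_zero_weylSeries,
    show (1 + s) / 2 = s / 2 + 1 / 2 by ring, scalarSeries_add]
  have e1 := (commute_expSeries_scalarSeries (s / 2) (varExp 0) adag).eq
  have e2 := (commute_scalarSeries (1 / 2) (expSeries (scalarSeries (s / 2)))).eq
  simp only [mul_add, add_mul, ← mul_assoc]
  rw [e1, e2]
  abel

theorem eulerOp_one_displacement (s : ℂ) :
    eulerOp (varWeight 1) (displacement s) =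
      (MvPowerSeries.monomial (varExp 1) ann + scalarSeries (-((1 - s) / 2))) *
        displacement s := by
  rw [displacement_eq, eulerOp_mul, eulerOp_expSeries_scalarSeries, eulerOp_one_weylSeries,
    show -((1 - s) / 2) = s / 2 + -(1 / 2) by ring, scalarSeries_add]
  have e1 := (commute_expSeries_scalarSeries (s / 2) (varExp 1) ann).eq
  have e2 := (commute_scalarSeries (-(1 / 2)) (expSeries (scalarSeries (s / 2)))).eq
  simp only [mul_add, add_mul, ← mul_assoc]
  rw [e1, e2]
  abel

/-! ### Multiplication by the ladder operators on symbols -/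

theorem sOrder_monomial (s : ℂ) (d : Fin 2 →₀ ℕ) :
    sOrder s (MvPolynomial.monomial d 1) =
      (((d 0)! : ℂ) * ((d 1)! : ℂ)) • MvPowerSeries.coeff d (displacement s) := by
  have h := (MvPolynomial.basisMonomials (Fin 2) ℂ).constr_basis ℂ (fun d : Fin 2 →₀ ℕ =>
    (((d 0)! : ℂ) * ((d 1)! : ℂ)) • MvPowerSeries.coeff d (displacement s)) d
  rwa [MvPolynomial.coe_basisMonomials] at h

theorem coeff_scalarSeries_mul (c : ℂ) (F : MvPowerSeries (Fin 2) Weyl) (d : Fin 2 →₀ ℕ)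
    (i j : Fin 2) (hij : varExp 0 + varExp 1 = varExp i + varExp j) :
    MvPowerSeries.coeff (varExp i + d) (scalarSeries c * F) =
      if d j = 0 then 0 else c • MvPowerSeries.coeff (d - varExp j) F := by
  simp only [scalarSeries, MvPowerSeries.coeff_monomial_mul, hij,
    add_le_add_iff_left, add_tsub_add_eq_tsub_left, ← Algebra.smul_def,
    Finsupp.single_le_iff, Nat.one_le_iff_ne_zero, ite_not]

/-- Comparing coefficients at `varExp i + d` in `h`: the weight `d i + 1` completes the factorial of
the raised monomial, and the scalar term lowers the exponent of the other variable, with the factor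
`d j` of a derivative. -/
theorem mul_sOrder_of_eulerOp (s c : ℂ) (x : Weyl) (i j : Fin 2) (hij : i ≠ j)
    (h : eulerOp (varWeight i) (displacement s) =
      (MvPowerSeries.monomial (varExp i) x + scalarSeries c) * displacement s)
    (F : MvPolynomial (Fin 2) ℂ) :
    x * sOrder s F =
      sOrder s (MvPolynomial.X i * F - c • MvPolynomial.pderiv j F) := by
  have hsum : varExp 0 + varExp 1 = varExp i + varExp j := by
    fin_cases i <;> fin_cases j <;> simp_all [add_comm]
  have key (d : Fin 2 →₀ ℕ) : x * sOrder s (MvPolynomial.monomial d 1) =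
      sOrder s (MvPolynomial.X i * MvPolynomial.monomial d 1 -
        c • MvPolynomial.pderiv j (MvPolynomial.monomial d 1)) := by
    have h1 := congrArg (MvPowerSeries.coeff (varExp i + d)) h
    rw [coeff_eulerOp, add_mul, (MvPowerSeries.coeff (varExp i + d)).map_add,
      MvPowerSeries.coeff_add_monomial_mul, coeff_scalarSeries_mul c _ d i j hsum,
      ← Nat.cast_smul_eq_nsmul ℂ] at h1
    have hfac (f : Fin 2 →₀ ℕ) : ((f 0)! : ℂ) * ((f 1)! : ℂ) = (f i)! * (f j)! := by
      fin_cases i <;> fin_cases j <;> simp_all [mul_comm]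
    have hX : (MvPolynomial.X i * MvPolynomial.monomial d 1 : MvPolynomial (Fin 2) ℂ) =
        MvPolynomial.monomial (varExp i + d) 1 := by
      rw [MvPolynomial.X, MvPolynomial.monomial_mul, one_mul]
    have hD : MvPolynomial.pderiv j (MvPolynomial.monomial d (1 : ℂ)) =
        (d j : ℂ) • MvPolynomial.monomial (d - varExp j) 1 := by
      rw [MvPolynomial.pderiv_monomial, MvPolynomial.smul_monomial, one_mul, smul_eq_mul, mul_one]
    have hi : (varExp i + d) i = d i + 1 := by simp [add_comm]
    have hj : (varExp i + d) j = d j := by simp [hij]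
    have hw : varWeight i (varExp i + d) = d i + 1 := hi
    rw [hX, hD, map_sub, map_smul, map_smul, sOrder_monomial, sOrder_monomial, sOrder_monomial,
      hfac, hfac (varExp i + d), hfac (d - varExp j), hi, hj, Nat.factorial_succ, mul_smul_comm]
    rw [hw] at h1
    rw [Nat.cast_mul, show ((d i + 1 : ℕ) : ℂ) * ((d i)! : ℂ) * ((d j)! : ℂ) =
      ((d i)! : ℂ) * ((d j)! : ℂ) * ((d i + 1 : ℕ) : ℂ) by ring, mul_smul _ ((d i + 1 : ℕ) : ℂ), h1,
      smul_add, eq_sub_iff_add_eq, add_right_inj]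
    split_ifs with hdj
    · simp [hdj]
    · have h2 : (d - varExp j) i = d i := by simp [hij]
      have h3 : (d - varExp j) j = d j - 1 := by simp
      rw [h2, h3, ← Nat.mul_factorial_pred hdj, smul_smul, smul_smul, smul_smul, Nat.cast_mul]
      congr 1
      ring
  induction F using MvPolynomial.induction_on' with
  | monomial d a =>
    have hd : MvPolynomial.monomial d a = a • (MvPolynomial.monomial d 1 : MvPolynomial _ ℂ) := by
      simp [MvPolynomial.smul_monomial]
    rw [hd, map_smul, mul_smul_comm, key, (MvPolynomial.pderiv j).map_smul, mul_smul_comm,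
      smul_comm c a, ← smul_sub, map_smul]
  | add p q hp hq =>
    rw [map_add, mul_add, hp, hq, map_add, ← map_add, mul_add, smul_add]
    congr 1
    abel

theorem adag_mul_sOrder (s : ℂ) (F : MvPolynomial (Fin 2) ℂ) :
    adag * sOrder s F =
      sOrder s (αstar * F - ((1 + s) / 2) • MvPolynomial.pderiv 1 F) :=
  mul_sOrder_of_eulerOp s _ adag 0 1 (by decide) (eulerOp_zero_displacement s) F

theorem ann_mul_sOrder (s : ℂ) (F : MvPolynomial (Fin 2) ℂ) :
    ann * sOrder s F =
      sOrder s (α * F - (-((1 - s) / 2)) • MvPolynomial.pderiv 0 F) :=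
  mul_sOrder_of_eulerOp s _ ann 1 0 (by decide) (eulerOp_one_displacement s) F

/-! ### Binomial series -/

theorem powSeries_zero (B c : ℂ) : powSeries B 0 c = 1 := by
  ext k
  rw [powSeries, PowerSeries.coeff_mk, PowerSeries.coeff_one]
  cases k with
  | zero => simp
  | succ k => simp [Finset.prod_range_succ']

theorem prod_add_one_sub_eq (ρ : ℂ) (k : ℕ) :
    ∏ j ∈ Finset.range (k + 1), (ρ + 1 - j * 1) =
      ∏ j ∈ Finset.range (k + 1), (ρ - j * 1) + (k + 1) * ∏ j ∈ Finset.range k, (ρ - j * 1) := by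
  rw [Finset.prod_range_succ', Finset.prod_range_succ]
  have h : ∏ j ∈ Finset.range k, (ρ + 1 - ((j + 1 : ℕ) : ℂ) * 1) =
      ∏ j ∈ Finset.range k, (ρ - j * 1) :=
    Finset.prod_congr rfl fun j _ => by push_cast; ring
  rw [h]
  push_cast
  ring

theorem powSeries_one_add_one (ρ c : ℂ) :
    powSeries 1 (ρ + 1) c = (1 + c • PowerSeries.X) * powSeries 1 ρ c := by
  ext k
  rw [add_mul, one_mul, smul_mul_assoc, map_add, map_smul]
  cases k with
  | zero => simp [powSeries]
  | succ k =>
    rw [PowerSeries.coeff_succ_X_mul]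
    simp only [powSeries, PowerSeries.coeff_mk, prod_add_one_sub_eq]
    have h1 : (k ! : ℂ) ≠ 0 := by exact_mod_cast k.factorial_ne_zero
    have h2 : (k + 1 : ℂ) ≠ 0 := by exact_mod_cast k.succ_ne_zero
    rw [Nat.factorial_succ, smul_eq_mul]
    push_cast
    field_simp
    ring

theorem powSeries_one_natCast (m : ℕ) (c : ℂ) :
    powSeries 1 m c = (1 + c • PowerSeries.X) ^ m := by
  induction m with
  | zero => simpa using powSeries_zero 1 c
  | succ m ih => rw [Nat.cast_succ, powSeries_one_add_one, ih, pow_succ']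

theorem powSeries_one_neg_natCast_mul (m : ℕ) (c : ℂ) :
    powSeries 1 (-(m : ℂ)) c * (1 + c • PowerSeries.X) ^ m = 1 := by
  induction m with
  | zero => simpa using powSeries_zero 1 c
  | succ m ih =>
    have h : -(m : ℂ) = -((m + 1 : ℕ) : ℂ) + 1 := by push_cast; ring
    rw [h, powSeries_one_add_one] at ih
    refine Eq.trans ?_ ih
    rw [pow_succ]
    ring

theorem derivative_powSubOneDiv (A c : ℂ) :
    PowerSeries.derivative ℂ (powSubOneDiv A 1 c) = (-c) • powSeries 1 (-A - 1) c := by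
  ext k
  rw [PowerSeries.coeff_derivative, map_smul, powSubOneDiv, powSeries, PowerSeries.coeff_mk,
    PowerSeries.coeff_mk, if_neg k.succ_ne_zero, Finset.prod_Ico_eq_prod_range]
  have h : ∏ j ∈ Finset.range k, (-A - 1 - (j : ℂ) * 1) =
      ∏ j ∈ Finset.range (k + 1 - 1), (-A - ((1 + j : ℕ) : ℂ) * 1) :=
    Finset.prod_congr rfl fun j _ => by push_cast; ring
  rw [h]
  have h1 : (k ! : ℂ) ≠ 0 := by exact_mod_cast k.factorial_ne_zero
  have h2 : (k + 1 : ℂ) ≠ 0 := by exact_mod_cast k.succ_ne_zero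
  rw [Nat.factorial_succ, smul_eq_mul]
  push_cast
  field_simp
  ring

/-- Clearing the denominator `A` keeps the identity valid at `A = 0`, so the case `e = 0` needs no
separate treatment. -/
theorem smul_powSubOneDiv (A B c : ℂ) :
    A • powSubOneDiv A B c = powSeries B (-A) c - 1 := by
  ext k
  rw [map_smul, map_sub, powSubOneDiv, powSeries, PowerSeries.coeff_mk,
    PowerSeries.coeff_mk, PowerSeries.coeff_one]
  cases k with
  | zero => simp
  | succ k =>
    rw [if_neg k.succ_ne_zero, if_neg k.succ_ne_zero, Finset.range_eq_Ico,
      Finset.prod_eq_prod_Ico_succ_bot k.succ_pos, smul_eq_mul]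
    push_cast
    ring

/-! ### Exponential Riordan polynomials -/

theorem coeff_pow_eq_zero_of_lt {h : PowerSeries ℂ} (hh : PowerSeries.constantCoeff h = 0)
    (F : PowerSeries ℂ) {n k : ℕ} (hnk : n < k) : PowerSeries.coeff n (F * h ^ k) = 0 := by
  obtain ⟨u, rfl⟩ := PowerSeries.X_dvd_iff.2 hh
  rw [mul_pow, mul_left_comm, PowerSeries.coeff_X_pow_mul', if_neg (by omega)]

theorem coeff_riordanPoly {h : PowerSeries ℂ} (hh : PowerSeries.constantCoeff h = 0)
    (F : PowerSeries ℂ) (n k : ℕ) :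
    (riordanPoly F h n).coeff k = (n ! : ℂ) / (k ! : ℂ) * PowerSeries.coeff n (F * h ^ k) := by
  simp only [riordanPoly, Polynomial.finsetSum_coeff, Polynomial.coeff_C_mul,
    Polynomial.coeff_X_pow, mul_ite, mul_one, mul_zero]
  rw [Finset.sum_ite_eq]
  split_ifs with hk
  · rfl
  · rw [Finset.mem_range] at hk
    rw [coeff_pow_eq_zero_of_lt hh F (by omega), mul_zero]

theorem riordanPoly_add {h : PowerSeries ℂ} (hh : PowerSeries.constantCoeff h = 0)
    (F G : PowerSeries ℂ) (n : ℕ) :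
    riordanPoly (F + G) h n = riordanPoly F h n + riordanPoly G h n := by
  ext k
  simp only [coeff_riordanPoly hh, Polynomial.coeff_add, add_mul, map_add, mul_add]

theorem riordanPoly_smul {h : PowerSeries ℂ} (hh : PowerSeries.constantCoeff h = 0) (c : ℂ)
    (F : PowerSeries ℂ) (n : ℕ) :
    riordanPoly (c • F) h n = c • riordanPoly F h n := by
  ext k
  simp only [coeff_riordanPoly hh, Polynomial.coeff_smul, smul_mul_assoc, map_smul, smul_eq_mul]
  ring

theorem derivative_riordanPoly {h : PowerSeries ℂ} (hh : PowerSeries.constantCoeff h = 0)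
    (F : PowerSeries ℂ) (n : ℕ) :
    Polynomial.derivative (riordanPoly F h n) = riordanPoly (F * h) h n := by
  ext k
  rw [Polynomial.coeff_derivative, coeff_riordanPoly hh, coeff_riordanPoly hh, mul_assoc F,
    ← pow_succ', Nat.factorial_succ]
  have h1 : (k ! : ℂ) ≠ 0 := by exact_mod_cast k.factorial_ne_zero
  have h2 : (k + 1 : ℂ) ≠ 0 := by exact_mod_cast k.succ_ne_zero
  push_cast
  field_simp

/-- The index shift is differentiation in z of F(z) exp(t h(z)), which gives (F' + t F h') exp(t h).
-/
theorem riordanPoly_succ {h : PowerSeries ℂ} (hh : PowerSeries.constantCoeff h = 0)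
    (F : PowerSeries ℂ) (n : ℕ) :
    riordanPoly F h (n + 1) = riordanPoly (PowerSeries.derivative ℂ F) h n +
      Polynomial.X * riordanPoly (F * PowerSeries.derivative ℂ h) h n := by
  have hn (G : PowerSeries ℂ) : ((n + 1) ! : ℂ) * PowerSeries.coeff (n + 1) G =
      (n ! : ℂ) * PowerSeries.coeff n (PowerSeries.derivative ℂ G) := by
    rw [PowerSeries.coeff_derivative, Nat.factorial_succ]
    push_cast
    ring
  ext k
  rw [Polynomial.coeff_add, coeff_riordanPoly hh, coeff_riordanPoly hh, div_mul_eq_mul_div, hn]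
  cases k with
  | zero => simp
  | succ k =>
    have h1 : (k ! : ℂ) ≠ 0 := by exact_mod_cast k.factorial_ne_zero
    have h2 : (k + 1 : ℂ) ≠ 0 := by exact_mod_cast k.succ_ne_zero
    have hd : PowerSeries.derivative ℂ (F * h ^ (k + 1)) =
        PowerSeries.derivative ℂ F * h ^ (k + 1) +
          (k + 1 : ℂ) • (F * PowerSeries.derivative ℂ h * h ^ k) := by
      rw [Derivation.leibniz, Derivation.leibniz_pow]
      simp only [smul_eq_mul, nsmul_eq_mul, Nat.add_sub_cancel, Algebra.smul_def,
        map_add, map_one, map_natCast, Nat.cast_add, Nat.cast_one]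
      ring
    rw [Polynomial.coeff_X_mul, coeff_riordanPoly hh, hd, map_add, map_smul, smul_eq_mul,
      Nat.factorial_succ]
    push_cast
    field_simp

theorem riordanPoly_X_mul_succ {h : PowerSeries ℂ} (hh : PowerSeries.constantCoeff h = 0)
    (F : PowerSeries ℂ) (n : ℕ) :
    riordanPoly (PowerSeries.X * F) h (n + 1) = (n + 1 : ℂ) • riordanPoly F h n := by
  ext k
  rw [Polynomial.coeff_smul, coeff_riordanPoly hh, coeff_riordanPoly hh, mul_assoc,
    PowerSeries.coeff_succ_X_mul, Nat.factorial_succ, smul_eq_mul]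
  push_cast
  ring

/-! ### Series identities for the compositional inverse -/

theorem derivative_pow_mul_self (F : PowerSeries ℂ) (m : ℕ) :
    PowerSeries.derivative ℂ (F ^ m) * F = m * F ^ m * PowerSeries.derivative ℂ F := by
  rw [Derivation.leibniz_pow]
  cases m with
  | zero => simp
  | succ m => simp only [smul_eq_mul, nsmul_eq_mul, Nat.add_sub_cancel]; ring

theorem derivative_one_add_C_mul (c : ℂ) (h : PowerSeries ℂ) :
    PowerSeries.derivative ℂ (1 + PowerSeries.C c * h) =
      PowerSeries.C c * PowerSeries.derivative ℂ h := by
  rw [map_add, Derivation.leibniz, PowerSeries.derivative_one, PowerSeries.derivative_C]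
  simp

theorem one_add_C_mul_ne_zero {h : PowerSeries ℂ} (hh : PowerSeries.constantCoeff h = 0) (c : ℂ) :
    1 + PowerSeries.C c * h ≠ 0 := by
  intro H
  simpa [hh] using congrArg PowerSeries.constantCoeff H

/-- The logarithmic derivative identity behind the recurrence of the two-point Hsu-Shiue
polynomials: `P = 1 + c' h` and `Q = 1 - c h` with `c + c' = 1`. -/
theorem derivative_eq_of_mul_pow_eq {L R e : ℕ} (he : L + R = e + 1) {c c' : ℂ} (hc : c + c' = 1)
    {h P Q ρ F : PowerSeries ℂ} (hP : P = 1 + PowerSeries.C c' * h)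
    (hQ : Q = 1 + PowerSeries.C (-c) * h) (hP0 : P ≠ 0) (hQ0 : Q ≠ 0)
    (h1 : F * P ^ e = P ^ R * Q ^ L)
    (h2 : F * PowerSeries.derivative ℂ h = ρ * P * Q ^ (e + 1)) :
    PowerSeries.derivative ℂ F =
      PowerSeries.C c' * (ρ * Q ^ (e + 1)) - (L : PowerSeries ℂ) * (ρ * Q ^ e) := by
  have hP' : PowerSeries.derivative ℂ P = PowerSeries.C c' * PowerSeries.derivative ℂ h := by
    rw [hP, derivative_one_add_C_mul]
  have hQ' : PowerSeries.derivative ℂ Q = PowerSeries.C (-c) * PowerSeries.derivative ℂ h := by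
    rw [hQ, derivative_one_add_C_mul]
  have hD := congrArg (PowerSeries.derivative ℂ) h1
  rw [Derivation.leibniz, Derivation.leibniz] at hD
  simp only [smul_eq_mul] at hD
  have d1 := derivative_pow_mul_self P e
  have d2 := derivative_pow_mul_self P R
  have d3 := derivative_pow_mul_self Q L
  rw [hP'] at d1 d2
  rw [hQ'] at d3
  have hC : PowerSeries.C c + PowerSeries.C c' = (1 : PowerSeries ℂ) := by
    rw [← map_add, hc, map_one]
  have hPQ : PowerSeries.C c * P + PowerSeries.C c' * Q = 1 := by
    rw [hP, hQ, map_neg]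
    linear_combination hC
  have heR : (L : PowerSeries ℂ) + R = e + 1 := by
    rw [← Nat.cast_add, he, Nat.cast_succ]
  rw [map_neg] at d3
  -- Formally F = P^(R-e) Q^L with R - e = 1 - L; the factor P^(e+1) Q clears the denominators of
  -- its logarithmic derivative.
  refine mul_right_cancel₀ (mul_ne_zero (pow_ne_zero (e + 1) hP0) hQ0) ?_
  linear_combination (P * Q) * hD - F * Q * d1 + P ^ (R + 1) * d3 + Q ^ (L + 1) * d2 -
    PowerSeries.derivative ℂ h * (R * PowerSeries.C c' * Q - L * PowerSeries.C c * P) * h1 +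
    PowerSeries.derivative ℂ h * F * P ^ e * PowerSeries.C c' * Q * heR -
    PowerSeries.derivative ℂ h * F * P ^ e * L * hPQ +
    P ^ e * (PowerSeries.C c' * Q - L) * h2

/-- Here `a`, `b`, `u`, `v` stand for Q^(-e), P^(-e), Q^(-L), P^(-R). Substituting `Z` into `F` and
using 1 - c' Q = c P gives the second formula; `hρ` times P^R Q^L turns it into the first. -/
theorem mul_pow_eq {L R e : ℕ} (he : L + R = e + 1) {c c' : ℂ}
    {P Q ρ F Z a b u v : PowerSeries ℂ}
    (hPQ : PowerSeries.C c * P + PowerSeries.C c' * Q = 1)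
    (ha : a * Q ^ e = 1) (hb : b * P ^ e = 1) (hu : u * Q ^ L = 1) (hv : v * P ^ R = 1)
    (hZ : Z = a - b)
    (hρ : ρ * (PowerSeries.C c * (P ^ L * u) + PowerSeries.C c' * (Q ^ R * v)) = 1)
    (hF : F = ρ - PowerSeries.C c' * (Z * (ρ * Q ^ (e + 1)))) :
    F * P ^ e = P ^ R * Q ^ L ∧
      F * P ^ e = ρ * (PowerSeries.C c * P ^ (e + 1) + PowerSeries.C c' * Q ^ (e + 1)) := by
  have h2 : F * P ^ e =
      ρ * (PowerSeries.C c * P ^ (e + 1) + PowerSeries.C c' * Q ^ (e + 1)) := by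
    rw [hF, hZ]
    linear_combination (ρ * P ^ e) * (-hPQ) - PowerSeries.C c' * ρ * P ^ e * Q * ha +
      PowerSeries.C c' * ρ * Q ^ (e + 1) * hb
  refine ⟨?_, h2⟩
  rw [h2, ← he, pow_add, pow_add]
  linear_combination (P ^ R * Q ^ L) * hρ - ρ * PowerSeries.C c * P ^ L * P ^ R * hu -
    ρ * PowerSeries.C c' * Q ^ R * Q ^ L * hv

theorem mul_derivative_eq {e : ℕ} {c c' : ℂ} {h P Q ρ F u v : PowerSeries ℂ} (hP0 : P ≠ 0)
    (hu : u * Q ^ (e + 1) = 1) (hv : v * P ^ (e + 1) = 1)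
    (hF : F * P ^ e = ρ * (PowerSeries.C c * P ^ (e + 1) + PowerSeries.C c' * Q ^ (e + 1)))
    (hh : (PowerSeries.C c * u + PowerSeries.C c' * v) * PowerSeries.derivative ℂ h = 1) :
    F * PowerSeries.derivative ℂ h = ρ * P * Q ^ (e + 1) := by
  refine mul_right_cancel₀ (pow_ne_zero e hP0) ?_
  linear_combination PowerSeries.derivative ℂ h * hF + ρ * P ^ (e + 1) * Q ^ (e + 1) * hh -
    ρ * PowerSeries.derivative ℂ h * PowerSeries.C c * P ^ (e + 1) * hu -
    ρ * PowerSeries.derivative ℂ h * PowerSeries.C c' * Q ^ (e + 1) * hv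

/-! ### Action of the ladder operators on symbols of Riordan polynomials -/

theorem pderiv_aeval_mul (i : Fin 2) (P : Polynomial ℂ) :
    MvPolynomial.pderiv i (Polynomial.aeval (αstar * α) P) =
      Polynomial.aeval (αstar * α) (Polynomial.derivative P) *
        MvPolynomial.pderiv i (αstar * α) := by
  rw [Derivation.map_aeval, smul_eq_mul]

theorem pderiv_one_symbol (m : ℕ) (P : Polynomial ℂ) :
    MvPolynomial.pderiv 1 (αstar ^ m * Polynomial.aeval (αstar * α) P) =
      αstar ^ (m + 1) * Polynomial.aeval (αstar * α) (Polynomial.derivative P) := by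
  rw [Derivation.leibniz, pderiv_aeval_mul, Derivation.leibniz_pow, Derivation.leibniz]
  have h0 : MvPolynomial.pderiv 1 αstar = 0 := MvPolynomial.pderiv_X_of_ne (by decide)
  have h1 : MvPolynomial.pderiv 1 α = 1 := MvPolynomial.pderiv_X_self _
  rw [h0, h1]
  simp only [smul_eq_mul, smul_zero, mul_zero, add_zero, mul_one]
  ring

theorem pderiv_zero_symbol (m : ℕ) (P : Polynomial ℂ) :
    MvPolynomial.pderiv 0 (αstar ^ (m + 1) * Polynomial.aeval (αstar * α) P) =
      αstar ^ m * Polynomial.aeval (αstar * α)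
        ((m + 1 : ℂ) • P + Polynomial.X * Polynomial.derivative P) := by
  rw [Derivation.leibniz, pderiv_aeval_mul, Derivation.leibniz_pow, Derivation.leibniz]
  have h0 : MvPolynomial.pderiv 0 αstar = 1 := MvPolynomial.pderiv_X_self _
  have h1 : MvPolynomial.pderiv 0 α = 0 := MvPolynomial.pderiv_X_of_ne (by decide)
  rw [h0, h1]
  simp only [smul_eq_mul, mul_zero, zero_add, mul_one, map_add, map_mul, map_smul,
    Polynomial.aeval_X, MvPolynomial.smul_eq_C_mul, map_one, map_natCast, nsmul_eq_mul,
    Nat.add_sub_cancel]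
  push_cast
  ring

theorem adag_mul_sOrder_symbol (s : ℂ) {h : PowerSeries ℂ}
    (hh : PowerSeries.constantCoeff h = 0) (F : PowerSeries ℂ) (m n : ℕ) :
    adag * sOrder s (αstar ^ m * Polynomial.aeval (αstar * α) (riordanPoly F h n)) =
      sOrder s (αstar ^ (m + 1) * Polynomial.aeval (αstar * α)
        (riordanPoly (F * (1 + PowerSeries.C (-((1 + s) / 2)) * h)) h n)) := by
  have hF : F * (1 + PowerSeries.C (-((1 + s) / 2)) * h) = F + (-((1 + s) / 2)) • (F * h) := by
    rw [PowerSeries.smul_eq_C_mul]; ring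
  rw [adag_mul_sOrder, pderiv_one_symbol, derivative_riordanPoly hh, hF, riordanPoly_add hh,
    riordanPoly_smul hh]
  congr 1
  rw [map_add, map_smul, mul_add, mul_smul_comm, neg_smul, ← sub_eq_add_neg, pow_succ']
  ring

theorem adag_pow_mul_sOrder_symbol (s : ℂ) {h : PowerSeries ℂ}
    (hh : PowerSeries.constantCoeff h = 0) (F : PowerSeries ℂ) (m n k : ℕ) :
    adag ^ k * sOrder s (αstar ^ m * Polynomial.aeval (αstar * α) (riordanPoly F h n)) =
      sOrder s (αstar ^ (m + k) * Polynomial.aeval (αstar * α)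
        (riordanPoly (F * (1 + PowerSeries.C (-((1 + s) / 2)) * h) ^ k) h n)) := by
  induction k with
  | zero => simp
  | succ k ih =>
    rw [pow_succ', mul_assoc, ih, adag_mul_sOrder_symbol s hh, mul_assoc F, ← pow_succ, add_assoc]

theorem ann_mul_sOrder_symbol (s : ℂ) {h : PowerSeries ℂ}
    (hh : PowerSeries.constantCoeff h = 0) (F : PowerSeries ℂ) (m n : ℕ) :
    ann * sOrder s (αstar ^ (m + 1) * Polynomial.aeval (αstar * α) (riordanPoly F h n)) =
      sOrder s (αstar ^ m * Polynomial.aeval (αstar * α)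
        (Polynomial.X * riordanPoly (F * (1 + PowerSeries.C ((1 - s) / 2) * h)) h n +
          ((1 - s) / 2 * (m + 1)) • riordanPoly F h n)) := by
  have hF : F * (1 + PowerSeries.C ((1 - s) / 2) * h) = F + ((1 - s) / 2) • (F * h) := by
    rw [PowerSeries.smul_eq_C_mul]; ring
  rw [ann_mul_sOrder, pderiv_zero_symbol, derivative_riordanPoly hh, hF, riordanPoly_add hh,
    riordanPoly_smul hh]
  congr 1
  simp only [map_add, map_mul, map_smul, Polynomial.aeval_X, MvPolynomial.smul_eq_C_mul, map_neg,
    map_natCast, map_one]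
  ring

theorem sOrder_one (s : ℂ) : sOrder s 1 = 1 := by
  have h := sOrder_monomial s 0
  rw [MvPolynomial.monomial_zero', map_one, displacement_eq, weylSeries,
    MvPowerSeries.coeff_mul] at h
  simpa [constantCoeff_expSeries] using h

/-- Each of the `L` creation operators moved past `ann` costs one a†^e. With `ann` leftmost it acts
on a symbol with a positive power of `αstar`, as `ann_mul_sOrder_symbol` requires. -/
theorem adag_pow_mul_ann_mul_adag_pow (L R e : ℕ) (he : L + R = e + 1) :
    adag ^ L * ann * adag ^ R = ann * adag ^ (e + 1) - (L : ℂ) • adag ^ e := by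
  induction L generalizing R with
  | zero => simp [← he]
  | succ L ih =>
    have h := ih (R + 1) (by omega)
    have h2 : adag * ann = ann * adag - 1 := by rw [ann_mul_adag, add_sub_cancel_right]
    have h3 : e = L + R := by omega
    rw [pow_succ, mul_assoc (adag ^ L), h2, mul_sub, mul_one, sub_mul, ← pow_add, ← h3,
      ← mul_assoc, mul_assoc _ adag, ← pow_succ', h, sub_sub, Nat.cast_succ, add_smul, one_smul]

/-! ### The recurrence of the two-point Hsu-Shiue polynomials -/

/-- The compositional inverse of `f_T` at `B = 1`. -/
abbrev fbar (A s : ℂ) : PowerSeries ℂ :=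
  (fT A 1 s).substInvOfIsUnit (isUnit_coeff_one_fT A 1 s)

theorem constantCoeff_fbar (A s : ℂ) : PowerSeries.constantCoeff (fbar A s) = 0 :=
  PowerSeries.constantCoeff_substInvOfIsUnit _ _

theorem hasSubst_fbar (A s : ℂ) : PowerSeries.HasSubst (fbar A s) :=
  PowerSeries.HasSubst.of_constantCoeff_zero' (constantCoeff_fbar A s)

theorem subst_one_add_smul_X {h : PowerSeries ℂ} (hh : PowerSeries.HasSubst h) (c : ℂ) :
    PowerSeries.substAlgHom hh (1 + c • PowerSeries.X : PowerSeries ℂ) = 1 + PowerSeries.C c * h := by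
  rw [map_add, map_one, map_smul, PowerSeries.substAlgHom_X, PowerSeries.smul_eq_C_mul]

theorem subst_powSeries_neg_mul {h : PowerSeries ℂ} (hh : PowerSeries.HasSubst h) (m : ℕ) (c : ℂ) :
    PowerSeries.substAlgHom hh (powSeries 1 (-(m : ℂ)) c) * (1 + PowerSeries.C c * h) ^ m = 1 := by
  rw [← subst_one_add_smul_X hh, ← map_pow, ← map_mul, powSeries_one_neg_natCast_mul, map_one]

theorem subst_powSeries_natCast {h : PowerSeries ℂ} (hh : PowerSeries.HasSubst h) (m : ℕ) (c : ℂ) :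
    PowerSeries.substAlgHom hh (powSeries 1 (m : ℂ) c) = (1 + PowerSeries.C c * h) ^ m := by
  rw [powSeries_one_natCast, map_pow, subst_one_add_smul_X hh]

theorem subst_C_mul {h : PowerSeries ℂ} (hh : PowerSeries.HasSubst h) (c : ℂ)
    (F : PowerSeries ℂ) : PowerSeries.substAlgHom hh (PowerSeries.C c * F) =
      PowerSeries.C c * PowerSeries.substAlgHom hh F := by
  rw [← PowerSeries.smul_eq_C_mul, map_smul, PowerSeries.smul_eq_C_mul]

theorem subst_gT {h : PowerSeries ℂ} (hh : PowerSeries.HasSubst h) (L R : ℕ) (s : ℂ) :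
    PowerSeries.substAlgHom hh (gT 1 (-(L : ℂ)) R s) =
      PowerSeries.C ((1 + s) / 2) * ((1 + PowerSeries.C ((1 - s) / 2) * h) ^ L *
        PowerSeries.substAlgHom hh (powSeries 1 (-(L : ℂ)) (-((1 + s) / 2)))) +
      PowerSeries.C ((1 - s) / 2) * ((1 + PowerSeries.C (-((1 + s) / 2)) * h) ^ R *
        PowerSeries.substAlgHom hh (powSeries 1 (-(R : ℂ)) ((1 - s) / 2))) := by
  rw [gT, map_add, subst_C_mul, subst_C_mul, map_mul, map_mul, neg_neg,
    subst_powSeries_natCast, subst_powSeries_natCast]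

/-- This is f_T ∘ f̄_T = X multiplied by `e`. -/
theorem natCast_mul_X_eq (e : ℕ) (s : ℂ) :
    (e : PowerSeries ℂ) * PowerSeries.X =
      PowerSeries.substAlgHom (hasSubst_fbar e s) (powSeries 1 (-(e : ℂ)) (-((1 + s) / 2))) -
      PowerSeries.substAlgHom (hasSubst_fbar e s) (powSeries 1 (-(e : ℂ)) ((1 - s) / 2)) := by
  have h1 : PowerSeries.substAlgHom (hasSubst_fbar e s) (fT e 1 s) = PowerSeries.X := by
    rw [PowerSeries.coe_substAlgHom]
    exact PowerSeries.subst_substInvOfIsUnit_right _ (constantCoeff_fT _ _ _) _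
  have h2 : (e : ℂ) • fT e 1 s =
      powSeries 1 (-(e : ℂ)) (-((1 + s) / 2)) - powSeries 1 (-(e : ℂ)) ((1 - s) / 2) := by
    rw [fT, smul_sub, smul_powSubOneDiv, smul_powSubOneDiv, sub_sub_sub_cancel_right]
  rw [← map_sub, ← h2, map_smul, h1, PowerSeries.smul_eq_C_mul, map_natCast]

/-- Chain rule applied to f_T ∘ f̄_T = X; the first factor is the derivative of f_T evaluated at
f̄_T. -/
theorem mul_derivative_fbar (e : ℕ) (s : ℂ) :
    (PowerSeries.C ((1 + s) / 2) * PowerSeries.substAlgHom (hasSubst_fbar e s)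
        (powSeries 1 (-((e + 1 : ℕ) : ℂ)) (-((1 + s) / 2))) +
      PowerSeries.C ((1 - s) / 2) * PowerSeries.substAlgHom (hasSubst_fbar e s)
        (powSeries 1 (-((e + 1 : ℕ) : ℂ)) ((1 - s) / 2))) *
      PowerSeries.derivative ℂ (fbar e s) = 1 := by
  have h1 : (fT e 1 s).subst (fbar e s) = PowerSeries.X :=
    PowerSeries.subst_substInvOfIsUnit_right _ (constantCoeff_fT _ _ _) _
  have h2 := PowerSeries.derivative_subst (f := fT e 1 s) (hasSubst_fbar e s)
  rw [h1, PowerSeries.derivative_X, ← PowerSeries.coe_substAlgHom (hasSubst_fbar e s), fT,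
    map_sub, derivative_powSubOneDiv, derivative_powSubOneDiv, neg_neg, neg_smul,
    sub_neg_eq_add, map_add, map_smul, map_smul, PowerSeries.smul_eq_C_mul,
    PowerSeries.smul_eq_C_mul, show -(e : ℂ) - 1 = -((e + 1 : ℕ) : ℂ) by push_cast; ring] at h2
  exact h2.symm

/-- The reciprocal of `g_T` composed with the inverse of `f_T`, at `A = e`, `B = 1`, `r = -L`,
`r' = R`. -/
abbrev gbar (L R e : ℕ) (s : ℂ) : PowerSeries ℂ :=
  ((gT 1 (-(L : ℂ)) R s).subst (fbar e s) : PowerSeries ℂ)⁻¹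

theorem constantCoeff_subst_gT (L R e : ℕ) (s : ℂ) : PowerSeries.constantCoeff
    ((gT 1 (-(L : ℂ)) R s).subst (fbar e s) : PowerSeries ℂ) = 1 := by
  have h : PowerSeries.constantCoeff
      ((gT 1 (-(L : ℂ)) R s - 1).subst (fbar e s) : PowerSeries ℂ) = 0 :=
    PowerSeries.constantCoeff_subst_eq_zero (constantCoeff_fbar e s) _
      (by rw [map_sub, constantCoeff_gT, map_one, sub_self])
  rwa [← PowerSeries.coe_substAlgHom (hasSubst_fbar e s), map_sub, map_one, map_sub, map_one,
    sub_eq_zero, PowerSeries.coe_substAlgHom] at h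

theorem gbar_mul (L R e : ℕ) (s : ℂ) :
    gbar L R e s * PowerSeries.substAlgHom (hasSubst_fbar e s) (gT 1 (-(L : ℂ)) R s) = 1 := by
  rw [PowerSeries.coe_substAlgHom]
  exact PowerSeries.inv_mul_cancel _ (by rw [constantCoeff_subst_gT]; exact one_ne_zero)

theorem riordanPoly_gbar_zero (L R e : ℕ) (s : ℂ) :
    riordanPoly (gbar L R e s) (fbar e s) 0 = 1 := by
  simp [riordanPoly, constantCoeff_subst_gT]

theorem riordanPoly_gbar_succ (L R e : ℕ) (he : L + R = e + 1) (s : ℂ) (n : ℕ) :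
    riordanPoly (gbar L R e s) (fbar e s) (n + 1) =
      Polynomial.X * riordanPoly (gbar L R e s *
        (1 + PowerSeries.C (-((1 + s) / 2)) * fbar e s) ^ (e + 1) *
        (1 + PowerSeries.C ((1 - s) / 2) * fbar e s)) (fbar e s) n +
      ((1 - s) / 2 * ((e * n + e : ℕ) + 1)) • riordanPoly (gbar L R e s *
        (1 + PowerSeries.C (-((1 + s) / 2)) * fbar e s) ^ (e + 1)) (fbar e s) n -
      (L : ℂ) • riordanPoly (gbar L R e s *
        (1 + PowerSeries.C (-((1 + s) / 2)) * fbar e s) ^ e) (fbar e s) n := by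
  have hh := constantCoeff_fbar e s
  have hs := hasSubst_fbar e s
  have hg := gbar_mul L R e s
  rw [subst_gT] at hg
  have hcc : (1 + s) / 2 + (1 - s) / 2 = 1 := by ring
  have hC : PowerSeries.C ((1 + s) / 2) + PowerSeries.C ((1 - s) / 2) = (1 : PowerSeries ℂ) := by
    rw [← map_add, hcc, map_one]
  have hφ := mul_derivative_fbar e s
  have hX := natCast_mul_X_eq e s
  have a1 := subst_powSeries_neg_mul hs e (-((1 + s) / 2))
  have a2 := subst_powSeries_neg_mul hs e ((1 - s) / 2)
  have a3 := subst_powSeries_neg_mul hs L (-((1 + s) / 2))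
  have a4 := subst_powSeries_neg_mul hs R ((1 - s) / 2)
  have a5 := subst_powSeries_neg_mul hs (e + 1) (-((1 + s) / 2))
  have a6 := subst_powSeries_neg_mul hs (e + 1) ((1 - s) / 2)
  have hP0 := one_add_C_mul_ne_zero hh ((1 - s) / 2)
  have hQ0 := one_add_C_mul_ne_zero hh (-((1 + s) / 2))
  generalize hP : 1 + PowerSeries.C ((1 - s) / 2) * fbar e s = P at *
  generalize hQ : 1 + PowerSeries.C (-((1 + s) / 2)) * fbar e s = Q at *
  generalize gbar L R e s = ρ at *
  have hPQ : PowerSeries.C ((1 + s) / 2) * P + PowerSeries.C ((1 - s) / 2) * Q = 1 := by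
    rw [← hP, ← hQ, map_neg]
    linear_combination hC
  obtain ⟨f1, f2⟩ := mul_pow_eq he hPQ a1 a2 a3 a4 hX hg rfl
  have f3 := mul_derivative_eq hP0 a5 a6 f2 hφ
  have f4 := derivative_eq_of_mul_pow_eq he hcc hP.symm hQ.symm hP0 hQ0 f1 f3
  -- The coefficient e n + e + 1 equals e (n+1) + 1, and its part e (n+1) comes from a factor X via
  -- `riordanPoly_X_mul_succ`. Splitting that part off `ρ` leaves the series F whose derivative is
  -- `f4`.
  have hsplit : ρ = (ρ - PowerSeries.C ((1 - s) / 2) *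
      (((e : PowerSeries ℂ) * PowerSeries.X) * (ρ * Q ^ (e + 1)))) +
      ((1 - s) / 2 * e) • (PowerSeries.X * (ρ * Q ^ (e + 1))) := by
    rw [PowerSeries.smul_eq_C_mul, map_mul, map_natCast]
    ring
  have hd : PowerSeries.C ((1 - s) / 2) * (ρ * Q ^ (e + 1)) - (L : PowerSeries ℂ) * (ρ * Q ^ e) =
      ((1 - s) / 2) • (ρ * Q ^ (e + 1)) + (-(L : ℂ)) • (ρ * Q ^ e) := by
    rw [PowerSeries.smul_eq_C_mul, PowerSeries.smul_eq_C_mul, map_neg, map_natCast]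
    ring
  conv_lhs => rw [hsplit]
  rw [riordanPoly_add hh, riordanPoly_succ hh, f3, f4, hd, riordanPoly_smul hh,
    riordanPoly_X_mul_succ hh, riordanPoly_add hh, riordanPoly_smul hh, riordanPoly_smul hh,
    mul_right_comm ρ P]
  simp only [Polynomial.smul_eq_C_mul, map_add, map_mul, map_neg, map_natCast, map_one]
  push_cast
  ring

end

end BosonOrdering

open BosonOrdering

theorem mainTheorem2 (L R e : ℕ) (he : L + R = e + 1) (s : ℂ) (n : ℕ) :
    (adag ^ L * ann * adag ^ R) ^ n =
      sOrder s (αstar ^ (e * n) *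
        Polynomial.aeval (αstar * α) (twoPointHS (e : ℂ) 1 (-(L : ℂ)) (R : ℂ) s n)) := by
  change _ = sOrder s (αstar ^ (e * n) *
    Polynomial.aeval (αstar * α) (riordanPoly (gbar L R e s) (fbar e s) n))
  induction n with
  | zero => simp [riordanPoly_gbar_zero, sOrder_one]
  | succ n ih =>
    have hh := constantCoeff_fbar e s
    rw [pow_succ', ih, adag_pow_mul_ann_mul_adag_pow L R e he, sub_mul, mul_assoc, smul_mul_assoc,
      adag_pow_mul_sOrder_symbol s hh, adag_pow_mul_sOrder_symbol s hh, ← add_assoc,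
      ann_mul_sOrder_symbol s hh, riordanPoly_gbar_succ L R e he s n, ← map_smul, ← map_sub,
      ← mul_smul_comm, ← mul_sub, ← map_smul, ← map_sub, mul_add e, mul_one]
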